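/- Let $(X,r)$ be a finite involutive solution: $X$ is a finite set and $r\colon X\times X\to X\times X$, $r(x,y)=(\sigma_x(y),\tau_y(x))$, satisfies $r^2=\mathrm{id}$ and the Yang--Baxter equation $(r\times\mathrm{id})(\mathrm{id}\times r)(r\times\mathrm{id})=(\mathrm{id}\times r)(r\times\mathrm{id})(\mathrm{id}\times r)$, and all maps $\sigma_x$ and $\tau_x$ are permutations of $X$. Let $G=G(X,r)$ be its structure group, i.e. the group (with operation $\circ$) generated by $X$ with relations $x\circ y=u\circ v$ whenever $r(x,y)=(u,v)$, let $\iota\colon X\to G$ be the canonical map, and let $\mathcal{G}(X,r)$ be the subgroup of the symmetric group of $X$ generated by all $\sigma_x$, $x\in X$. A skew left brace structure on $G$ with multiplicative group $(G,\circ)$ is a (not necessarily commutative) group operation $+$ on the set $G$ with $a\circ(b+c)=a\circ b-a+a\circ c$ for all $a,b,c$; put $\lambda_a(b)=-a+a\circ b$ and $r_G(a,b)=(\lambda_a(b),\lambda_a(b)^{-1}\circ a\circ b)$, the inverse being taken with respect to $\circ$. A group is an $n$-dimensional Bieberbach group if it has no non-trivial element of finite order and has a normal subgroup $A\simeq\mathbb{Z}^n$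 of finite index that equals its own centralizer; such an $A$ is called a translation subgroup, and the quotient by $A$ is the corresponding holonomy group. Then: (1) there is exactly one skew left brace structure on $G$ with multiplicative group $(G,\circ)$ such that $r_G\circ(\iota\times\iota)=(\iota\times\iota)\circ r$; let $\mathrm{Soc}(G)=\{a\in G:\lambda_a=\mathrm{id}\text{ and }a+b=b+a\text{ for all }b\in G\}$ be its socle; (2) $G$ is a Bieberbach group of dimension $|X|$; (3) the socle $\mathrm{Soc}(G)$ is the one and only translation subgroup of $G$ (of any dimension $n$, and then $n=|X|$); (4) the holonomy group $G/\mathrm{Soc}(G)$ is isomorphic to $\mathcal{G}(X,r)$. -/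

import Mathlib

/-- A (non-degenerate) set-theoretic solution of the Yang-Baxter equation on `X`,
with `r (x, y) = (σ_x y, τ_y x)`. -/
structure YBSolution (X : Type*) where
  /-- the map `r : X × X → X × X` -/
  r : X × X → X × X
  bijective : Function.Bijective r
  /-- `(r × id)(id × r)(r × id) = (id × r)(r × id)(id × r)` on `X × X × X`; the two local
  functions are `r × id` and `id × r`. -/
  braid :
    let r₁₂ : X × X × X → X × X × X := fun t =>
      ((r (t.1, t.2.1)).1, (r (t.1, t.2.1)).2, t.2.2)
    let r₂₃ : X × X × X → X × X × X := fun t => (t.1, r t.2)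
    r₁₂ ∘ r₂₃ ∘ r₁₂ = r₂₃ ∘ r₁₂ ∘ r₂₃
  /-- every `σ_x` is a permutation of `X` -/
  left_bijective : ∀ x, Function.Bijective fun y => (r (x, y)).1
  /-- every `τ_y` is a permutation of `X` -/
  right_bijective : ∀ y, Function.Bijective fun x => (r (x, y)).2

namespace YBSolution

variable {X : Type*}

/-- The solution is involutive: `r² = id`. -/
def IsInvolutive (S : YBSolution X) : Prop := ∀ p, S.r (S.r p) = p

/-- The permutation `σ_x : y ↦ (r (x, y)).1` of `X`. -/
noncomputable def σ (S : YBSolution X) (x : X) : Equiv.Perm X :=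
  Equiv.ofBijective (fun y => (S.r (x, y)).1) (S.left_bijective x)

/-- The defining relations `x y = u v` whenever `r (x, y) = (u, v)`. -/
def rels (S : YBSolution X) : Set (FreeGroup X) :=
  {w | ∃ x y u v : X, S.r (x, y) = (u, v) ∧
    w = FreeGroup.of x * FreeGroup.of y * (FreeGroup.of u * FreeGroup.of v)⁻¹}

/-- The structure group `G(X, r)`. -/
abbrev StructureGroup (S : YBSolution X) : Type _ := PresentedGroup S.rels

/-- The canonical map `ι : X → G(X, r)`. -/
def ι (S : YBSolution X) (x : X) : S.StructureGroup := PresentedGroup.of x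

/-- The permutation group of the solution: the subgroup of the symmetric group of `X`
generated by all `σ_x`. -/
def permutationGroup (S : YBSolution X) : Subgroup (Equiv.Perm X) :=
  Subgroup.closure (Set.range S.σ)

end YBSolution

/-- A skew left brace structure on a set `A` whose multiplicative group `(A, ∘)` is the given
group, written `*`: an additive (not necessarily commutative) group structure on `A` with
`a ∘ (b + c) = a ∘ b - a + a ∘ c`. -/
class SkewLeftBrace (A : Type*) [Group A] extends AddGroup A where
  mul_add_brace : ∀ a b c : A, a * (b + c) = a * b - a + a * c

namespace SkewLeftBrace

variable {A : Type*} [Group A]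

/-- `λ_a (b) = -a + a ∘ b`. -/
def lam (B : SkewLeftBrace A) (a b : A) : A := -a + a * b

/-- The map `r_A (a, b) = (λ_a b, (λ_a b)' ∘ a ∘ b)`, where `'` is the inverse for `∘`. -/
def rMap (B : SkewLeftBrace A) (p : A × A) : A × A :=
  (B.lam p.1 p.2, (B.lam p.1 p.2)⁻¹ * p.1 * p.2)

/-- The neutral elements of `+` and `∘` coincide. -/
theorem one_eq_zero (B : SkewLeftBrace A) : (1 : A) = 0 := by
  have h := B.mul_add_brace 1 0 0
  simp only [add_zero, one_mul, zero_sub] at h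
  exact neg_eq_zero.mp h.symm

/-- If `λ_a b = b` then `a ∘ b = a + b`. -/
theorem mul_eq_add_of_lam (B : SkewLeftBrace A) {a b : A} (h : B.lam a b = b) :
    a * b = a + b := by
  have h' : -a + a * b = b := h
  rw [neg_add_eq_iff_eq_add] at h'
  exact h'

/-- The socle `Soc(A) = ker λ ∩ Z(A, +)`, as a subgroup of `(A, ∘)`. -/
def socle (B : SkewLeftBrace A) : Subgroup A where
  carrier := {a | (∀ b, B.lam a b = b) ∧ ∀ b, a + b = b + a}
  one_mem' := by
    refine ⟨fun b => ?_, fun b => ?_⟩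
    · change -(1 : A) + 1 * b = b
      rw [one_mul, B.one_eq_zero, neg_zero, zero_add]
    · rw [B.one_eq_zero, zero_add, add_zero]
  mul_mem' := by
    rintro a b ⟨ha, ha'⟩ ⟨hb, hb'⟩
    refine ⟨fun c => ?_, fun c => ?_⟩
    · change -(a * b) + a * b * c = c
      rw [mul_assoc, B.mul_eq_add_of_lam (hb c), B.mul_eq_add_of_lam (ha (b + c)),
        B.mul_eq_add_of_lam (ha b), ← add_assoc a b c, neg_add_cancel_left]
    · rw [B.mul_eq_add_of_lam (ha b), add_assoc, hb' c, ← add_assoc, ha' c, add_assoc]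
  inv_mem' := by
    rintro a ⟨ha, ha'⟩
    have hinv : a⁻¹ = -a := by
      rw [inv_eq_iff_mul_eq_one, B.mul_eq_add_of_lam (ha (-a)), add_neg_cancel, B.one_eq_zero]
    refine ⟨fun b => ?_, fun b => ?_⟩
    · change -a⁻¹ + a⁻¹ * b = b
      have h : a⁻¹ * b = -a + b := by
        rw [inv_mul_eq_iff_eq_mul, B.mul_eq_add_of_lam (ha (-a + b)), add_neg_cancel_left]
      rw [h, hinv, neg_neg, add_neg_cancel_left]
    · rw [hinv, neg_add_eq_iff_eq_add, ← add_assoc, ha' b, add_neg_cancel_right]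

end SkewLeftBrace

/-- `B` is a skew left brace structure on the structure group, with multiplicative group
`G(X, r)`, such that `r_{G(X, r)} (ι × ι) = (ι × ι) r`. -/
def YBSolution.IsStructureBrace {X : Type*} (S : YBSolution X)
    (B : SkewLeftBrace S.StructureGroup) : Prop :=
  ∀ x y : X, B.rMap (S.ι x, S.ι y) = Prod.map S.ι S.ι (S.r (x, y))

/-- `A` is a normal subgroup of `G`, isomorphic to `ℤⁿ` (so abelian), of finite index, and
equal to its own centralizer in `G`. -/
structure IsTranslationSubgroup {G : Type*} [Group G] (n : ℕ) (A : Subgroup G) : Prop where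
  normal : A.Normal
  equiv : Nonempty (A ≃* Multiplicative (Fin n → ℤ))
  finiteIndex : A.FiniteIndex
  centralizer_eq : Subgroup.centralizer (A : Set G) = A

/-- `G` is an `n`-dimensional Bieberbach group: it has no nontrivial element of finite order,
and it has a translation subgroup isomorphic to `ℤⁿ`. (Mathlib's `IsMulTorsionFree` is unique
extraction of roots, which is stronger than torsion-freeness for nonabelian groups.) -/
def IsBieberbach (n : ℕ) (G : Type*) [Group G] : Prop :=
  (∀ g : G, IsOfFinOrder g → g = 1) ∧ ∃ A : Subgroup G, IsTranslationSubgroup n A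

namespace IsTranslationSubgroup

variable {G : Type*} [Group G] {n : ℕ} {A : Subgroup G}

/-- The holonomy group `G / A` with respect to the translation subgroup `A`. -/
def HolonomyGroup (_ : IsTranslationSubgroup n A) : Type _ := G ⧸ A

/-- The quotient group structure. -/
instance (h : IsTranslationSubgroup n A) : Group h.HolonomyGroup :=
  haveI := h.normal
  inferInstanceAs (Group (G ⧸ A))

end IsTranslationSubgroup

/-!
Let `G` be the structure group. Sending `x` to `σ_x` followed by the translation by the basis vector `x`
respects the defining relations, so it extends to an affine representation `affineHom` of `G` on
the lattice `ℤ^X`, with translation part a `1`-cocycle `π : G → ℤ^X` and linear part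
`φ : G → Sym(X)` with image the permutation group of the solution. The key point is that `π` is
bijective (`cocycle_bijective`), that is, `G` acts simply transitively on `ℤ^X`. Since
`a ↦ σ_a⁻¹ a` is a permutation of `X` (`diagonal_injective`), the maps
`g ↦ g * ι (φ(g)⁻¹ y)`, for `y` in `X`, are permutations of `G`; the defining relations say
precisely that they commute, so they assemble into an action of `ℤ^X` on `G`, whose orbit map at
`1` is inverse to `π`.

* Carrying the addition of `ℤ^X` back along `π` gives the brace. In any compatible brace the
  generators `ι x` generate the additive group and `a + ι x = a * ι (φ(a)⁻¹ x)`, so `π` is additive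
  (`IsStructureBrace.cocycle_add`) and the brace is unique. Its socle is `ker φ`.
* A torsion element fixes the barycentre of an orbit in `ℚ^X`. As `G` acts by permutations of the
  coordinates and integral translations, it also fixes the integral part of that point, which lies
  in `ℤ^X`, where the action is free (`eq_one_of_isOfFinOrder`).
* On `ker φ` the cocycle is an injective homomorphism, with image of finite index in `ℤ^X`; hence
  `ker φ` is free abelian of rank `|X|`. An element centralizing it acts trivially on a sublattice
  of finite index, so it lies in `ker φ` (`centralizer_ker`).
* Any two translation subgroups `A`, `B` of a group agree: for `a ∈ A` and `b ∈ B` some power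
  `b ^ k` lies in `A`, so `a b a⁻¹` and `b` are elements of the torsion-free abelian group `B` with
  the same `k`-th power (`IsTranslationSubgroup.unique`).
-/

namespace YBSolution

variable {X : Type*} (S : YBSolution X)

/-! ### Identities of an involutive solution -/

theorem σ_apply (x y : X) : S.σ x y = (S.r (x, y)).1 := rfl

/-- The first component of the braid relation. -/
theorem σ_mul_σ (x y : X) :
    S.σ x * S.σ y = S.σ (S.r (x, y)).1 * S.σ (S.r (x, y)).2 := by
  ext z
  exact (congrArg Prod.fst (congrFun S.braid (x, y, z))).symm

theorem ι_mul_ι (x y : X) :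
    S.ι x * S.ι y = S.ι (S.r (x, y)).1 * S.ι (S.r (x, y)).2 := by
  rw [← mul_inv_eq_one]
  exact (PresentedGroup.one_of_mem (rels := S.rels) ⟨x, y, _, _, rfl, rfl⟩)

variable {S}

theorem IsInvolutive.σ_r (hS : S.IsInvolutive) (x y : X) :
    S.σ (S.r (x, y)).1 (S.r (x, y)).2 = x := by
  rw [σ_apply, Prod.mk.eta, hS]

/-- Involutivity determines `τ` from `σ`. -/
theorem IsInvolutive.r_eq (hS : S.IsInvolutive) (x y : X) :
    S.r (x, y) = (S.σ x y, (S.σ (S.σ x y))⁻¹ x) := by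
  ext
  · rfl
  · rw [Equiv.Perm.eq_inv_iff_eq]
    exact hS.σ_r x y

/-- The defining relations, reparametrized so that the two sides are exchanged by swapping `a`
and `b`. -/
theorem IsInvolutive.ι_mul_ι_σ_inv (hS : S.IsInvolutive) (a b : X) :
    S.ι a * S.ι ((S.σ a)⁻¹ b) = S.ι b * S.ι ((S.σ b)⁻¹ a) := by
  rw [S.ι_mul_ι, hS.r_eq]
  simp

/-- The map `T : a ↦ σ_a⁻¹ a` is injective: involutivity gives `r (a, T a) = (a, T a)`, so that
`a` is recovered from `T a` as its preimage under `τ_{T a}`. -/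
theorem IsInvolutive.diagonal_injective (hS : S.IsInvolutive) :
    Function.Injective fun a => (S.σ a)⁻¹ a := by
  have key (a : X) : S.r (a, (S.σ a)⁻¹ a) = (a, (S.σ a)⁻¹ a) := by
    rw [hS.r_eq]; simp
  intro a b (hab : (S.σ a)⁻¹ a = (S.σ b)⁻¹ b)
  apply (S.right_bijective ((S.σ a)⁻¹ a)).injective
  change (S.r _).2 = (S.r _).2
  rw [key, hab, key]

/-! ### The affine representation on `ℤ^X` -/

section Affine

open Multiplicative

theorem structureGroup_induction {p : S.StructureGroup → Prop} (one : p 1)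
    (mul_ι : ∀ g x, p g → p (g * S.ι x)) (mul_ι_inv : ∀ g x, p g → p (g * (S.ι x)⁻¹))
    (g : S.StructureGroup) : p g := by
  have hg : g ∈ Subgroup.closure (Set.range (PresentedGroup.of (rels := S.rels))) := by
    rw [PresentedGroup.closure_range_of]; trivial
  induction hg using Subgroup.closure_induction_right with
  | one => exact one
  | mul_right g _ y hy ih => obtain ⟨x, rfl⟩ := hy; exact mul_ι g x ih
  | mul_inv_cancel g _ y hy ih => obtain ⟨x, rfl⟩ := hy; exact mul_ι_inv g x ih

open scoped Classical in
/-- The homomorphism from the structure group to the integral affine group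
`ℤ^X ⋊ Sym(X)` which sends `x` to `σ_x` followed by the translation by the basis vector `x`.
The lattice `ℤ^X` is written multiplicatively, as `X → Multiplicative ℤ`. -/
noncomputable def IsInvolutive.affineHom (hS : S.IsInvolutive) :
    S.StructureGroup →* (X → Multiplicative ℤ) ⋊[mulAutArrow] Equiv.Perm X :=
  PresentedGroup.toGroup (f := fun x => ⟨Pi.mulSingle x (ofAdd 1), S.σ x⟩) (by
    rintro _ ⟨x, y, u, v, h, rfl⟩
    have hu : u = S.σ x y := by rw [σ_apply, h]
    have hv : S.σ u v = x := by simpa [h] using hS.σ_r x y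
    have hσ := S.σ_mul_σ x y
    rw [h] at hσ
    have key (a b c : X) : mulAutArrow (S.σ a) (Pi.mulSingle b (ofAdd (1 : ℤ))) c =
        (Pi.mulSingle (S.σ a b) (ofAdd (1 : ℤ)) : X → Multiplicative ℤ) c := by
      change (Pi.mulSingle b (ofAdd (1 : ℤ)) : X → Multiplicative ℤ) ((S.σ a)⁻¹ c) = _
      simp only [Pi.mulSingle_apply, Equiv.Perm.inv_eq_iff_eq]
    simp only [map_mul, map_inv, FreeGroup.lift_apply_of]
    rw [mul_inv_eq_one]
    ext c
    · simp only [SemidirectProduct.mul_left, Pi.mul_apply, key]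
      rw [hv, ← hu, mul_comm]
    · simp only [SemidirectProduct.mul_right, hσ])

/-- The linear part of the affine representation: the homomorphism `x ↦ σ_x`. -/
noncomputable def IsInvolutive.permHom (hS : S.IsInvolutive) :
    S.StructureGroup →* Equiv.Perm X :=
  SemidirectProduct.rightHom.comp hS.affineHom

/-- The translation part of the affine representation: the `1`-cocycle `G → ℤ^X` that sends
each `x` to the corresponding basis vector. -/
noncomputable def IsInvolutive.cocycle (hS : S.IsInvolutive) (g : S.StructureGroup) : X → ℤ :=
  fun x => toAdd ((hS.affineHom g).left x)

variable (hS : S.IsInvolutive)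

theorem IsInvolutive.permHom_ι (x : X) : hS.permHom (S.ι x) = S.σ x := by
  simp [permHom, affineHom, ι]

open scoped Classical in
theorem IsInvolutive.cocycle_ι (x : X) : hS.cocycle (S.ι x) = Pi.single x 1 := by
  ext y
  by_cases h : y = x
  · subst h; simp [cocycle, affineHom, ι]
  · simp [cocycle, affineHom, ι, h]

theorem IsInvolutive.cocycle_mul (g h : S.StructureGroup) (x : X) :
    hS.cocycle (g * h) x = hS.cocycle g x + hS.cocycle h ((hS.permHom g)⁻¹ x) := by
  simp only [cocycle, permHom, map_mul]
  rfl

theorem IsInvolutive.cocycle_one : hS.cocycle 1 = 0 := by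
  ext x; simp [cocycle]

open scoped Classical in
theorem IsInvolutive.cocycle_mul_ι (g : S.StructureGroup) (x : X) :
    hS.cocycle (g * S.ι x) = hS.cocycle g + Pi.single (hS.permHom g x) 1 := by
  ext y
  simp [hS.cocycle_mul, hS.cocycle_ι, Pi.single_apply, Equiv.symm_apply_eq]

end Affine

end YBSolution

namespace YBSolution.IsInvolutive

open Multiplicative

variable {X : Type*} {S : YBSolution X} (hS : S.IsInvolutive)

/-! ### The cocycle is bijective -/

/-- Right multiplication by a generator, twisted so that the cocycle turns it into the
translation by the basis vector `y` of `ℤ^X`. It is a permutation of the structure group because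
`a ↦ σ_a⁻¹ a` is one of `X`. -/
noncomputable def translate [Finite X] (y : X) : Equiv.Perm S.StructureGroup :=
  Equiv.ofBijective (fun g => g * S.ι ((hS.permHom g)⁻¹ y)) (by
    constructor
    · intro g h hgh
      have hab : (hS.permHom g)⁻¹ y = (hS.permHom h)⁻¹ y := by
        apply hS.diagonal_injective
        have h1 := congrArg hS.permHom hgh
        simp only [map_mul, hS.permHom_ι] at h1
        have h2 := congrArg (fun p : Equiv.Perm X => p⁻¹ y) h1
        simpa only [mul_inv_rev, Equiv.Perm.mul_apply] using h2
      simpa [hab] using hgh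
    · intro h
      obtain ⟨a, ha⟩ := (Finite.injective_iff_surjective.mp hS.diagonal_injective)
        ((hS.permHom h)⁻¹ y)
      refine ⟨h * (S.ι a)⁻¹, ?_⟩
      have : (hS.permHom (h * (S.ι a)⁻¹))⁻¹ y = a := by
        simp only [map_mul, map_inv, hS.permHom_ι, mul_inv_rev, inv_inv, Equiv.Perm.mul_apply,
          ← ha]
        exact Equiv.apply_symm_apply _ _
      simp only [this, inv_mul_cancel_right])

theorem translate_apply [Finite X] (y : X) (g : S.StructureGroup) :
    hS.translate y g = g * S.ι ((hS.permHom g)⁻¹ y) := rfl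

open scoped Classical in
theorem cocycle_translate [Finite X] (y : X) (g : S.StructureGroup) :
    hS.cocycle (hS.translate y g) = hS.cocycle g + Pi.single y 1 := by
  rw [translate_apply, cocycle_mul_ι, Equiv.Perm.inv_def, Equiv.apply_symm_apply]

theorem translate_commute [Finite X] (y z : X) :
    Commute (hS.translate y) (hS.translate z) := by
  ext g
  simp only [Equiv.Perm.mul_apply, translate_apply, map_mul, permHom_ι, mul_inv_rev, mul_assoc,
    hS.ι_mul_ι_σ_inv]

/-- The action of the lattice `ℤ^X` on the structure group by twisted right multiplications. -/
noncomputable def latticeAction [Fintype X] :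
    (X → Multiplicative ℤ) →* Equiv.Perm S.StructureGroup :=
  MonoidHom.noncommPiCoprod (fun y => zpowersHom _ (hS.translate y))
    fun y z _ m n => by
      simp only [zpowersHom_apply]
      exact (hS.translate_commute y z).zpow_zpow _ _

open scoped Classical in
theorem latticeAction_mulSingle [Fintype X] (y : X) :
    hS.latticeAction (Pi.mulSingle y (ofAdd 1)) = hS.translate y := by
  rw [latticeAction]
  convert! MonoidHom.noncommPiCoprod_mulSingle (N := fun _ => Multiplicative ℤ) _ y
    (ofAdd (1 : ℤ))

/-- The lattice acts on the values of the cocycle by translations. -/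
theorem cocycle_latticeAction [Fintype X] (d : X → Multiplicative ℤ) (g : S.StructureGroup) :
    hS.cocycle (hS.latticeAction d g) = hS.cocycle g + fun x => toAdd (d x) := by
  classical
  let H : Subgroup (X → Multiplicative ℤ) :=
    { carrier := {d | ∀ g, hS.cocycle (hS.latticeAction d g) =
        hS.cocycle g + fun x => toAdd (d x)}
      one_mem' := fun g => by ext; simp
      mul_mem' := fun {d e} hd he g => by
        rw [map_mul, Equiv.Perm.mul_apply, hd, he]
        ext; simp [add_comm, add_left_comm]
      inv_mem' := fun {d} hd g => by
        have h := hd (hS.latticeAction d⁻¹ g)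
        rw [← Equiv.Perm.mul_apply, ← map_mul, mul_inv_cancel, map_one, Equiv.Perm.one_apply] at h
        rw [h]
        ext; simp }
  have hgen (y : X) : Pi.mulSingle y (ofAdd (1 : ℤ)) ∈ H := fun g => by
    rw [latticeAction_mulSingle, cocycle_translate]
    ext x
    by_cases h : x = y
    · subst h; simp
    · simp [h]
  have hd : d ∈ H := by
    rw [← Finset.univ_prod_mulSingle d]
    refine H.prod_mem fun y _ => ?_
    have h : Pi.mulSingle y (d y) =
        (Pi.mulSingle y (ofAdd (1 : ℤ)) : X → Multiplicative ℤ) ^ (toAdd (d y)) := by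
      rw [← Pi.mulSingle_zpow, ← ofAdd_zsmul]; simp
    rw [h]
    exact H.zpow_mem (hgen y) _
  exact hd g

/-- The orbit map of the identity under the lattice action is a left inverse of the cocycle. -/
theorem latticeAction_cocycle [Fintype X] (g : S.StructureGroup) :
    hS.latticeAction (fun x => ofAdd (hS.cocycle g x)) 1 = g := by
  classical
  have key (g : S.StructureGroup) (x : X) :
      hS.latticeAction (fun y => ofAdd (hS.cocycle (g * S.ι x) y)) 1 =
        hS.translate (hS.permHom g x) (hS.latticeAction (fun y => ofAdd (hS.cocycle g y)) 1) := by
    rw [← latticeAction_mulSingle, ← Equiv.Perm.mul_apply, ← map_mul]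
    congr 2
    ext y
    rw [cocycle_mul_ι]
    by_cases h : y = hS.permHom g x
    · subst h; simp [add_comm]
    · simp [h]
  have hι (g : S.StructureGroup) (x : X) : hS.translate (hS.permHom g x) g = g * S.ι x := by
    rw [translate_apply, Equiv.Perm.inv_def, Equiv.symm_apply_apply]
  induction g using structureGroup_induction with
  | one =>
    rw [cocycle_one]
    exact DFunLike.congr_fun (map_one hS.latticeAction) 1
  | mul_ι g x ih => rw [key, ih, hι]
  | mul_ι_inv g x ih =>
    have h := key (g * (S.ι x)⁻¹) x
    rw [inv_mul_cancel_right, ih] at h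
    apply (hS.translate (hS.permHom (g * (S.ι x)⁻¹) x)).injective
    rw [← h, hι, inv_mul_cancel_right]

theorem cocycle_bijective [Finite X] : Function.Bijective hS.cocycle := by
  have := Fintype.ofFinite X
  refine ⟨fun g h hgh => ?_, fun d => ⟨hS.latticeAction (fun x => ofAdd (d x)) 1, ?_⟩⟩
  · rw [← hS.latticeAction_cocycle g, hgh, latticeAction_cocycle]
  · rw [cocycle_latticeAction, cocycle_one, zero_add]
    rfl

end YBSolution.IsInvolutive

/-! ### The skew left brace structure -/

namespace SkewLeftBrace

variable {A : Type*} [Group A] (B : SkewLeftBrace A)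

theorem add_lam (a b : A) : a + B.lam a b = a * b :=
  add_neg_cancel_left a (a * b)

theorem lam_add (a b c : A) : B.lam a (b + c) = B.lam a b + B.lam a c := by
  simp only [lam, B.mul_add_brace, sub_eq_add_neg, add_assoc]

theorem lam_mul (a b c : A) : B.lam (a * b) c = B.lam a (B.lam b c) := by
  have h : a * b + B.lam (a * b) c = a * b + B.lam a (B.lam b c) := by
    rw [add_lam, ← B.add_lam a b, add_assoc, ← lam_add, add_lam, add_lam, add_lam, mul_assoc]
  exact add_left_cancel h

theorem lam_one (b : A) : B.lam 1 b = b := by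
  rw [lam, one_mul, B.one_eq_zero, neg_zero, zero_add]

theorem mul_lam_inv (a b : A) : a * B.lam a⁻¹ b = a + b := by
  rw [← add_lam, ← lam_mul, mul_inv_cancel, lam_one]

/-- A skew left brace structure is determined by its addition. -/
theorem ext_add {B C : SkewLeftBrace A}
    (h : ∀ a b : A, B.toAddGroup.toAdd.add a b = C.toAddGroup.toAdd.add a b) : B = C := by
  have key : B.toAddGroup = C.toAddGroup := by
    apply AddGroup.ext
    funext a b
    exact h a b
  cases B; cases C
  congr

end SkewLeftBrace

namespace YBSolution

variable {X : Type*} {S : YBSolution X}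

namespace IsStructureBrace

variable {B : SkewLeftBrace S.StructureGroup}

theorem lam_ι (hB : S.IsStructureBrace B) (x y : X) :
    B.lam (S.ι x) (S.ι y) = S.ι (S.σ x y) :=
  congrArg Prod.fst (hB x y)

theorem lam_ι_inv (hB : S.IsStructureBrace B) (x y : X) :
    B.lam (S.ι x)⁻¹ (S.ι y) = S.ι ((S.σ x)⁻¹ y) := by
  have h := hB.lam_ι x ((S.σ x)⁻¹ y)
  rw [Equiv.Perm.inv_def, Equiv.apply_symm_apply, ← Equiv.Perm.inv_def] at h
  rw [← h, ← B.lam_mul, inv_mul_cancel, B.lam_one]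

/-- In a compatible brace, `λ` acts on the generators through the permutations `σ_x`. -/
theorem lam_apply_ι (hS : S.IsInvolutive) (hB : S.IsStructureBrace B) (g : S.StructureGroup)
    (x : X) : B.lam g (S.ι x) = S.ι (hS.permHom g x) := by
  induction g using structureGroup_induction generalizing x with
  | one => rw [B.lam_one, map_one]; rfl
  | mul_ι g y ih => rw [B.lam_mul, hB.lam_ι, ih, map_mul, hS.permHom_ι]; rfl
  | mul_ι_inv g y ih =>
    rw [B.lam_mul, hB.lam_ι_inv, ih, map_mul, map_inv, hS.permHom_ι]; rfl

/-- In a compatible brace the generators generate the additive group. -/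
theorem closure_ι_eq_top (hS : S.IsInvolutive) (hB : S.IsStructureBrace B) :
    AddSubgroup.closure (Set.range S.ι) = (⊤ : AddSubgroup S.StructureGroup) := by
  rw [eq_top_iff]
  rintro g -
  induction g using structureGroup_induction with
  | one => rw [B.one_eq_zero]; exact zero_mem _
  | mul_ι g x ih =>
    rw [← B.add_lam, lam_apply_ι hS hB]
    exact add_mem ih (AddSubgroup.subset_closure ⟨_, rfl⟩)
  | mul_ι_inv g x ih =>
    have h : g * (S.ι x)⁻¹ + B.lam (g * (S.ι x)⁻¹) (S.ι x) = g := by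
      rw [B.add_lam, inv_mul_cancel_right]
    rw [← eq_add_neg_iff_add_eq] at h
    rw [h, lam_apply_ι hS hB]
    exact add_mem ih (neg_mem (AddSubgroup.subset_closure ⟨_, rfl⟩))

theorem add_ι (hS : S.IsInvolutive) (hB : S.IsStructureBrace B) (g : S.StructureGroup) (x : X) :
    g + S.ι x = g * S.ι ((hS.permHom g)⁻¹ x) := by
  rw [← B.mul_lam_inv, lam_apply_ι hS hB, map_inv]

/-- The cocycle turns the addition of any compatible brace into that of `ℤ^X`: this holds for
the translations `g ↦ g + ι x`, and the generators `ι x` generate the additive group. -/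
theorem cocycle_add (hS : S.IsInvolutive) (hB : S.IsStructureBrace B) (a b : S.StructureGroup) :
    hS.cocycle (a + b) = hS.cocycle a + hS.cocycle b := by
  classical
  have hι (a : S.StructureGroup) (x : X) :
      hS.cocycle (a + S.ι x) = hS.cocycle a + Pi.single x 1 := by
    rw [add_ι hS hB, hS.cocycle_mul_ι, Equiv.Perm.inv_def, Equiv.apply_symm_apply]
  have hι_neg (a : S.StructureGroup) (x : X) :
      hS.cocycle (a + -S.ι x) = hS.cocycle a - Pi.single x 1 := by
    rw [eq_sub_iff_add_eq, ← hι, neg_add_cancel_right]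
  have hb : b ∈ AddSubgroup.closure (Set.range S.ι) := by
    rw [closure_ι_eq_top hS hB]; exact AddSubgroup.mem_top b
  induction hb using AddSubgroup.closure_induction_right with
  | zero => rw [add_zero, ← B.one_eq_zero, hS.cocycle_one, add_zero]
  | add_right b _ y hy ih =>
    obtain ⟨x, rfl⟩ := hy
    rw [← add_assoc, hι, hι, ih, add_assoc]
  | add_neg_cancel b _ y hy ih =>
    obtain ⟨x, rfl⟩ := hy
    rw [← add_assoc, hι_neg, hι_neg, ih, add_sub_assoc]

/-- There is at most one compatible brace, because its addition is determined by the bijective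
cocycle. -/
theorem unique [Finite X] (hS : S.IsInvolutive) {C : SkewLeftBrace S.StructureGroup}
    (hB : S.IsStructureBrace B) (hC : S.IsStructureBrace C) : B = C :=
  SkewLeftBrace.ext_add fun a b => hS.cocycle_bijective.injective <|
    (cocycle_add hS hB a b).trans (cocycle_add hS hC a b).symm

end IsStructureBrace

/-- The brace structure carried back from the lattice `ℤ^X` along the bijective cocycle. -/
@[reducible]
noncomputable def IsInvolutive.brace [Finite X] (hS : S.IsInvolutive) :
    SkewLeftBrace S.StructureGroup :=
  let e := Equiv.ofBijective _ hS.cocycle_bijective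
  letI : AddGroup S.StructureGroup := e.addGroup
  { e.addGroup with
    mul_add_brace := fun a b c => by
      have hadd (a b : S.StructureGroup) : hS.cocycle (a + b) = hS.cocycle a + hS.cocycle b :=
        e.apply_symm_apply _
      have hsub (a b : S.StructureGroup) : hS.cocycle (a - b) = hS.cocycle a - hS.cocycle b :=
        e.apply_symm_apply _
      apply hS.cocycle_bijective.injective
      ext x
      simp only [hadd, hsub, hS.cocycle_mul, Pi.add_apply, Pi.sub_apply]
      ring }

namespace IsInvolutive

variable [Finite X] (hS : S.IsInvolutive)

theorem cocycle_brace_lam (a b : S.StructureGroup) (x : X) :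
    hS.cocycle (hS.brace.lam a b) x = hS.cocycle b ((hS.permHom a)⁻¹ x) := by
  let e := Equiv.ofBijective _ hS.cocycle_bijective
  have hadd (a b : S.StructureGroup) :
      hS.cocycle (hS.brace.toAddGroup.toAdd.add a b) = hS.cocycle a + hS.cocycle b :=
    e.apply_symm_apply _
  have h := congrArg hS.cocycle (hS.brace.add_lam a b)
  have h' := (hadd a (hS.brace.lam a b)).symm.trans h
  have h'' := congrFun h' x
  rw [hS.cocycle_mul, Pi.add_apply] at h''
  exact add_left_cancel h''

theorem brace_add_comm (a b : S.StructureGroup) :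
    hS.brace.toAddGroup.toAdd.add a b = hS.brace.toAddGroup.toAdd.add b a := by
  let e := Equiv.ofBijective _ hS.cocycle_bijective
  exact congrArg e.symm (add_comm (e a) (e b))

theorem isStructureBrace_brace : S.IsStructureBrace hS.brace := by
  classical
  intro x y
  have h1 : hS.brace.lam (S.ι x) (S.ι y) = S.ι (S.r (x, y)).1 := by
    apply hS.cocycle_bijective.injective
    ext z
    rw [cocycle_brace_lam, cocycle_ι, cocycle_ι, permHom_ι, ← σ_apply]
    simp [Pi.single_apply, Equiv.symm_apply_eq]
  ext
  · exact h1
  · change (hS.brace.lam (S.ι x) (S.ι y))⁻¹ * S.ι x * S.ι y = S.ι (S.r (x, y)).2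
    rw [h1, mul_assoc, S.ι_mul_ι, inv_mul_cancel_left]

theorem existsUnique_isStructureBrace (hS : S.IsInvolutive) :
    ∃! B : SkewLeftBrace S.StructureGroup, S.IsStructureBrace B :=
  ⟨hS.brace, hS.isStructureBrace_brace,
    fun _ hB => IsStructureBrace.unique hS hB hS.isStructureBrace_brace⟩

/-- The additive group of the brace is commutative, so the socle is the kernel of `λ`, which is
the kernel of the action on the generators. -/
theorem socle_eq_ker {B : SkewLeftBrace S.StructureGroup} (hB : S.IsStructureBrace B) :
    B.socle = hS.permHom.ker := by
  classical
  obtain rfl := IsStructureBrace.unique hS hB hS.isStructureBrace_brace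
  ext a
  rw [MonoidHom.mem_ker]
  constructor
  · rintro ⟨h, -⟩
    ext x
    have h1 := (IsStructureBrace.lam_apply_ι hS hB a x).symm.trans (h (S.ι x))
    have h2 := congrFun (congrArg hS.cocycle h1) x
    rw [cocycle_ι, cocycle_ι] at h2
    by_contra hx
    change hS.permHom a x ≠ x at hx
    rw [Pi.single_eq_same, Pi.single_eq_of_ne' hx] at h2
    exact zero_ne_one h2
  · intro h
    refine ⟨fun b => hS.cocycle_bijective.injective ?_, fun b => hS.brace_add_comm a b⟩
    ext x
    rw [cocycle_brace_lam, h]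
    rfl

end IsInvolutive

end YBSolution

namespace YBSolution.IsInvolutive

variable {X : Type*} {S : YBSolution X} (hS : S.IsInvolutive)

/-! ### Torsion-freeness -/

theorem cocycle_mul_eq_of_mem_ker {k : S.StructureGroup} (hk : k ∈ hS.permHom.ker)
    (g : S.StructureGroup) : hS.cocycle (k * g) = hS.cocycle k + hS.cocycle g := by
  ext x
  rw [cocycle_mul, MonoidHom.mem_ker.mp hk]
  rfl

/-- The structure group acts simply transitively on `ℤ^X` by `g • v = π g + φ g v`. An element
of finite order `m` fixes the barycentre `(∑ i < m, π (g ^ i)) / m` of an orbit, hence also its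
integral part, because `π g` is integral and `φ g` permutes the coordinates. -/
theorem eq_one_of_isOfFinOrder [Finite X] (hS : S.IsInvolutive) (g : S.StructureGroup)
    (hg : IsOfFinOrder g) : g = 1 := by
  obtain ⟨m, hm, hgm⟩ := isOfFinOrder_iff_pow_eq_one.mp hg
  let s (x : X) : ℤ := ∑ i ∈ Finset.range m, hS.cocycle (g ^ i) x
  have hs (x : X) : s x = s ((hS.permHom g)⁻¹ x) + m * hS.cocycle g x := by
    have h1 : s x = ∑ i ∈ Finset.range m, hS.cocycle (g ^ (i + 1)) x := by
      have h2 := (Finset.sum_range_succ (fun i => hS.cocycle (g ^ i) x) m).symm.trans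
        (Finset.sum_range_succ' (fun i => hS.cocycle (g ^ i) x) m)
      rw [hgm, pow_zero] at h2
      exact add_right_cancel h2
    rw [h1]
    simp only [pow_succ', cocycle_mul, Finset.sum_add_distrib, s]
    simp [add_comm]
  obtain ⟨h, hh⟩ := hS.cocycle_bijective.surjective fun x => s x / m
  have hfix : g * h = h := by
    apply hS.cocycle_bijective.injective
    ext x
    rw [cocycle_mul, hh]
    simp only
    rw [hs x, Int.add_mul_ediv_left _ _ (by exact_mod_cast hm.ne'), add_comm]
  simpa using hfix

/-! ### The kernel of the permutation representation as a lattice -/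

/-- The cocycle restricted to the kernel of the permutation representation is a homomorphism;
this is its image in `ℤ^X`. -/
noncomputable def kerLattice : AddSubgroup (X → ℤ) where
  carrier := hS.cocycle '' hS.permHom.ker
  zero_mem' := ⟨1, one_mem _, hS.cocycle_one⟩
  add_mem' := by
    rintro _ _ ⟨k, hk, rfl⟩ ⟨l, hl, rfl⟩
    exact ⟨k * l, mul_mem hk hl, hS.cocycle_mul_eq_of_mem_ker hk l⟩
  neg_mem' := by
    rintro _ ⟨k, hk, rfl⟩
    refine ⟨k⁻¹, inv_mem hk, ?_⟩
    rw [eq_neg_iff_add_eq_zero, ← hS.cocycle_mul_eq_of_mem_ker (inv_mem hk), inv_mul_cancel,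
      cocycle_one]

theorem range_permHom : hS.permHom.range = S.permutationGroup := by
  apply le_antisymm
  · rintro _ ⟨g, rfl⟩
    induction g using structureGroup_induction with
    | one => rw [map_one]; exact one_mem _
    | mul_ι g x ih =>
      rw [map_mul, permHom_ι]
      exact mul_mem ih (Subgroup.subset_closure ⟨x, rfl⟩)
    | mul_ι_inv g x ih =>
      rw [map_mul, map_inv, permHom_ι]
      exact mul_mem ih (inv_mem (Subgroup.subset_closure ⟨x, rfl⟩))
  · rw [permutationGroup, Subgroup.closure_le]
    rintro _ ⟨x, rfl⟩
    exact ⟨S.ι x, hS.permHom_ι x⟩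

variable [Finite X]

theorem finiteIndex_ker : hS.permHom.ker.FiniteIndex :=
  Subgroup.finiteIndex_ker _

/-- Elements with the same image under `permHom` have cocycle values in the same coset of
`kerLattice`, so there are no more cosets than permutations of `X`. -/
theorem kerLattice_finiteIndex : hS.kerLattice.FiniteIndex := by
  let e := Equiv.ofBijective _ hS.cocycle_bijective
  let f : (X → ℤ) ⧸ hS.kerLattice → Equiv.Perm X := fun q => hS.permHom (e.symm q.out)
  have hf : Function.Injective f := by
    intro p q hpq
    rw [← p.out_eq', ← q.out_eq']
    apply QuotientAddGroup.eq.mpr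
    have hk : e.symm q.out * (e.symm p.out)⁻¹ ∈ hS.permHom.ker := by
      rw [MonoidHom.mem_ker, map_mul, map_inv, mul_inv_eq_one]
      exact hpq.symm
    refine ⟨_, hk, ?_⟩
    have h := hS.cocycle_mul_eq_of_mem_ker hk (e.symm p.out)
    rw [inv_mul_cancel_right] at h
    have hp : hS.cocycle (e.symm p.out) = p.out := e.apply_symm_apply _
    have hq : hS.cocycle (e.symm q.out) = q.out := e.apply_symm_apply _
    rw [hp, hq] at h
    rw [eq_neg_add_iff_add_eq, add_comm]
    exact h.symm
  have := Finite.of_injective f hf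
  exact AddSubgroup.finiteIndex_of_finite_quotient

theorem nonempty_kerLattice_equiv :
    Nonempty (hS.kerLattice ≃+ (Fin (Nat.card X) → ℤ)) := by
  have := Fintype.ofFinite X
  have hidx := hS.kerLattice_finiteIndex.index_ne_zero
  let L : Submodule ℤ (X → ℤ) := AddSubgroup.toIntSubmodule hS.kerLattice
  have hle : Module.finrank ℤ L ≤ Nat.card X := by
    have h := Submodule.finrank_le L
    rwa [Module.finrank_fintype_fun_eq_card, ← Nat.card_eq_fintype_card] at h
  -- Multiplication by the index embeds the whole lattice into the sublattice.
  let f : (X → ℤ) →ₗ[ℤ] L :=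
    LinearMap.codRestrict L ((hS.kerLattice.index : ℤ) • LinearMap.id) fun d => by
      have h := hS.kerLattice.nsmul_index_mem d
      rw [← natCast_zsmul] at h
      exact h
  have hf : Function.Injective f := by
    intro c d hcd
    have h := congrArg Subtype.val hcd
    ext x
    have hx := congrFun h x
    simpa [f, hidx] using hx
  have hge : Nat.card X ≤ Module.finrank ℤ L := by
    have h := LinearMap.finrank_le_finrank_of_injective hf
    rwa [Module.finrank_fintype_fun_eq_card, ← Nat.card_eq_fintype_card] at h
  exact ⟨((Module.finBasisOfFinrankEq ℤ L (hle.antisymm hge)).equivFun).toAddEquiv⟩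

/-- The kernel of the permutation representation is isomorphic to `kerLattice`. -/
noncomputable def kerEquiv : hS.permHom.ker ≃* Multiplicative hS.kerLattice :=
  MulEquiv.ofBijective
    (MonoidHom.mk' (fun k => Multiplicative.ofAdd ⟨hS.cocycle k, k, k.2, rfl⟩) fun k l => by
      apply Multiplicative.toAdd.injective
      exact Subtype.ext (hS.cocycle_mul_eq_of_mem_ker k.2 l))
    ⟨fun k l h => by
        have h' : hS.cocycle k = hS.cocycle l :=
          congrArg (fun d : Multiplicative hS.kerLattice =>
            ((Multiplicative.toAdd d : hS.kerLattice) : X → ℤ)) h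
        exact Subtype.ext (hS.cocycle_bijective.injective h'),
      fun d => by
        obtain ⟨_, k, hk, rfl⟩ := d
        exact ⟨⟨k, hk⟩, rfl⟩⟩

theorem nonempty_ker_equiv :
    Nonempty (hS.permHom.ker ≃* Multiplicative (Fin (Nat.card X) → ℤ)) := by
  obtain ⟨e⟩ := hS.nonempty_kerLattice_equiv
  exact ⟨hS.kerEquiv.trans (AddEquiv.toMultiplicative e)⟩

/-- The kernel is self-centralizing: `g` commutes with `k` in the kernel exactly when `φ g` fixes
the vector `π k`, and the vectors `π k` span a sublattice of finite index, which contains a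
multiple of each basis vector. -/
theorem centralizer_ker :
    Subgroup.centralizer (hS.permHom.ker : Set S.StructureGroup) = hS.permHom.ker := by
  classical
  apply le_antisymm
  · intro g hg
    have hidx := hS.kerLattice_finiteIndex.index_ne_zero
    rw [MonoidHom.mem_ker]
    ext x
    obtain ⟨k, hk, hkx⟩ := hS.kerLattice.nsmul_index_mem (Pi.single x 1)
    have h := congrArg hS.cocycle (Subgroup.mem_centralizer_iff.mp hg k hk)
    have h1 := congrFun h (hS.permHom g x)
    rw [hS.cocycle_mul_eq_of_mem_ker hk, cocycle_mul, hkx] at h1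
    by_contra hx
    change hS.permHom g x ≠ x at hx
    simp [hx, hidx] at h1
  · intro k hk
    rw [Subgroup.mem_centralizer_iff]
    intro l hl
    apply hS.cocycle_bijective.injective
    rw [hS.cocycle_mul_eq_of_mem_ker hk, hS.cocycle_mul_eq_of_mem_ker hl, add_comm]

theorem isTranslationSubgroup_ker : IsTranslationSubgroup (Nat.card X) hS.permHom.ker where
  normal := inferInstance
  equiv := hS.nonempty_ker_equiv
  finiteIndex := hS.finiteIndex_ker
  centralizer_eq := hS.centralizer_ker

end YBSolution.IsInvolutive

/-! ### Uniqueness of the translation subgroup -/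

namespace IsTranslationSubgroup

variable {G : Type*} [Group G] {m n : ℕ} {A B : Subgroup G}

theorem mul_comm_of_mem (hA : IsTranslationSubgroup n A) {a b : G} (ha : a ∈ A) (hb : b ∈ A) :
    a * b = b * a := by
  rw [← hA.centralizer_eq] at hb
  exact Subgroup.mem_centralizer_iff.mp hb a ha

theorem eq_of_pow_eq (hA : IsTranslationSubgroup n A) {a b : G} (ha : a ∈ A) (hb : b ∈ A)
    {k : ℕ} (hk : k ≠ 0) (h : a ^ k = b ^ k) : a = b := by
  obtain ⟨e⟩ := hA.equiv
  have h1 : e ⟨a, ha⟩ ^ k = e ⟨b, hb⟩ ^ k := by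
    rw [← map_pow, ← map_pow]
    exact congrArg e (Subtype.ext h)
  have h2 : e ⟨a, ha⟩ = e ⟨b, hb⟩ := by
    apply Multiplicative.toAdd.injective
    ext i
    have h3 := congrFun (congrArg Multiplicative.toAdd h1) i
    simpa [hk] using h3
  exact congrArg Subtype.val (e.injective h2)

/-- For `a ∈ A` and `b ∈ B`, some power `b ^ k` lies in `A`, so `b` and `a b a⁻¹` are elements
of `B` with the same `k`-th power, whence they are equal. -/
theorem le (hA : IsTranslationSubgroup m A) (hB : IsTranslationSubgroup n B) : A ≤ B := by
  have := hA.finiteIndex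
  intro a ha
  rw [← hB.centralizer_eq, Subgroup.mem_centralizer_iff]
  intro b hb
  obtain ⟨k, hk, -, hbk⟩ := Subgroup.exists_pow_mem_of_index_ne_zero
    this.index_ne_zero b
  have h : (a * b * a⁻¹) ^ k = b ^ k := by
    rw [conj_pow, hA.mul_comm_of_mem ha hbk, mul_inv_cancel_right]
  have h1 := hB.eq_of_pow_eq (hB.normal.conj_mem b hb a) hb hk.ne' h
  rw [mul_inv_eq_iff_eq_mul] at h1
  exact h1.symm

theorem unique (hA : IsTranslationSubgroup m A) (hB : IsTranslationSubgroup n B) :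
    m = n ∧ A = B := by
  obtain rfl : A = B := le_antisymm (hA.le hB) (hB.le hA)
  obtain ⟨e⟩ := hA.equiv
  obtain ⟨f⟩ := hB.equiv
  have g : (Fin m → ℤ) ≃+ (Fin n → ℤ) := AddEquiv.toMultiplicative.symm (e.symm.trans f)
  have h := g.toIntLinearEquiv.finrank_eq
  simpa using h

end IsTranslationSubgroup

/-! ### Structure groups as Bieberbach groups -/

theorem theorem2p2 {X : Type*} [Finite X] (S : YBSolution X) (hS : S.IsInvolutive) :
    -- the structure group has exactly one compatible skew left brace structure
    (∃! B : SkewLeftBrace S.StructureGroup, S.IsStructureBrace B) ∧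
    IsBieberbach (Nat.card X) S.StructureGroup ∧
    -- its translation subgroup is the socle of that brace
    (∀ B : SkewLeftBrace S.StructureGroup, S.IsStructureBrace B →
      ∀ (n : ℕ) (A : Subgroup S.StructureGroup),
        IsTranslationSubgroup n A ↔ n = Nat.card X ∧ A = B.socle) ∧
    -- its holonomy group is isomorphic to the permutation group
    (∀ (n : ℕ) (A : Subgroup S.StructureGroup) (h : IsTranslationSubgroup n A),
      Nonempty (h.HolonomyGroup ≃* S.permutationGroup)) := by
  refine ⟨hS.existsUnique_isStructureBrace,
    ⟨hS.eq_one_of_isOfFinOrder, _, hS.isTranslationSubgroup_ker⟩,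
    fun B hB n A => ⟨fun hA => ?_, ?_⟩, fun n A hA => ?_⟩
  · rw [hS.socle_eq_ker hB]
    exact hA.unique hS.isTranslationSubgroup_ker
  · rintro ⟨rfl, rfl⟩
    rw [hS.socle_eq_ker hB]
    exact hS.isTranslationSubgroup_ker
  · obtain ⟨rfl, rfl⟩ := hA.unique hS.isTranslationSubgroup_ker
    exact ⟨(QuotientGroup.quotientKerEquivRange hS.permHom).trans
      (MulEquiv.subgroupCongr hS.range_permHom)⟩
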